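/- **Setting.** Let $S$ be a finite set of sellers, $0\le t_0<t_f$, $\rho\in\mathbb R$, $\pi_{\min}\ge 0$, $\pi_{\max}>0$, $D_{\min}>0$, $\tau>0$, $m\in\mathbb N$, and let $K_s\in\mathbb R$ be the initial inventory of seller $s$. Prices $\pi_s$ and realized demands $D_s$ are elements of $L^2[t_0,t_f]$; a price $\pi_s$ is feasible if $\pi_{\min}\le\pi_s(t)\le\pi_{\max}$ for a.e. $t$. The uncertain parameter of seller $s$ ranges over the ball $U_s=\{\xi_s^0+\tau\psi:\|\psi\|\le 1\}$ of the Hilbert space $(L^2[t_0,t_f])^m$, where $\|\psi\|^2=\int_{t_0}^{t_f}\psi(t)^T\psi(t)\,dt$. For $t\in[t_0,t_f]$, a price vector $p=(p_s,p_{-s})\in\mathbb R^S$ and a parameter $\xi_s$, let $h_s(t,p;\xi_s)\in\mathbb R$ be the demand observed by seller $s$ at time $t$ when the prices charged at time $t$ are $p$; write $h_s(\pi(t);\xi_s)=h_s(t,\pi(t);\xi_s)$, and let $\nabla_{\xi_s}h_s(\pi(t);\xi_s)\in (L^2[t_0,t_f])^m$ be the gradient with respect to the parameter. Assume, for every $s\in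 S$, every $t\in[t_0,t_f]$, every $p\in[\pi_{\min},\pi_{\max}]^S$ and every $\xi_s\in U_s$: * (regularity) $h_s$ is continuous in $p$ on $[\pi_{\min},\pi_{\max}]^S$, and $t\mapsto h_s(\pi(t);\xi_s)$ is in $L^2[t_0,t_f]$ for all feasible price paths $\pi=(\pi_r)_{r\in S}$; * (A1) $\sup_{\xi_s,p_{-s}}h_s(t,\pi_{\max},p_{-s};\xi_s)=0$, the supremum being over $\xi_s\in U_s$ and $p_{-s}\in[\pi_{\min},\pi_{\max}]^{S\setminus\{s\}}$; * (A3) $h_s$ is concave in $p$ on $[\pi_{\min},\pi_{\max}]^S$; * (A4) for all feasible competitors' prices $\bar\pi_{-s}$ and all feasible $\pi_s^1\ne\pi_s^2$ in $L^2[t_0,t_f]$, $$\int_{t_0}^{t_f}e^{-t}\bigl[h_s(\pi_s^1(t),\bar\pi_{-s}(t);\xi_s)-h_s(\pi_s^2(t),\bar\pi_{-s}(t);\xi_s)\bigr]\bigl(\pi_s^1(t)-\pi_s^2(t)\bigr)\,dt<0;$$ * (A5) $h_s$ is twice continuously differentiable and linear in the parameter on $U_s$: $\partial^2h_s/\partial\xi_s^2=0$;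 * (A6) $\|\nabla_{\xi_s}h_s(t,p_s,p_{-s};\xi_s)\|$ is monotone increasing (in the weak sense) in own price $p_s\in[\pi_{\min},\pi_{\max}]$. **Theorem (existence of a robust best response).** For every seller $s\in S$ and all feasible prices $\pi_{-s}$ of the competitors, the robust best response problem of seller $s$, $$\max_{(\pi_s,D_s)\in L^2[t_0,t_f]\times L^2[t_0,t_f]}\ \int_{t_0}^{t_f}e^{-\rho t}\pi_s(t)D_s(t)\,dt$$ subject to $$D_s(t)-h_s(\pi_s(t),\pi_{-s}(t);\xi_s^0)+\tau\bigl\|\nabla_{\xi_s}h_s(\pi_s(t),\pi_{-s}(t);\xi_s^0)\bigr\|\le 0,\qquad K_s=\int_{t_0}^{t_f}D_s(t)\,dt,$$ $$\pi_{\min}\le\pi_s(t)\le\pi_{\max},\qquad D_s(t)\ge D_{\min}$$ (pointwise constraints for a.e. $t\in[t_0,t_f]$), has a solution whenever these constraints can be satisfied. -/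

import Mathlib

open MeasureTheory Set
open scoped Gradient

/-- Lebesgue measure on the planning horizon `[t₀, t_f]`. -/
noncomputable abbrev horizonMeasure (t₀ t_f : ℝ) : Measure ℝ :=
  volume.restrict (Icc t₀ t_f)

/-- The Hilbert space `L²[t₀, t_f]` of price paths and of realized-demand paths. -/
abbrev PathSpace (t₀ t_f : ℝ) : Type :=
  Lp ℝ 2 (horizonMeasure t₀ t_f)

/-- The Hilbert space `(L²[t₀, t_f])^m` of uncertain parameters, whose norm is
`‖ψ‖² = ∫ ψ(t)ᵀ ψ(t) dt`. -/
abbrev ParamSpace (t₀ t_f : ℝ) (m : ℕ) : Type :=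
  Lp (EuclideanSpace ℝ (Fin m)) 2 (horizonMeasure t₀ t_f)

/-- The data of the oligopolistic pricing model with set of sellers `S` and `m` uncertain
parameters per seller. -/
structure PricingModel (S : Type*) (m : ℕ) where
  /-- initial time -/
  t₀ : ℝ
  /-- terminal time -/
  t_f : ℝ
  /-- discount rate -/
  ρ : ℝ
  /-- lower price bound -/
  priceMin : ℝ
  /-- upper price bound -/
  priceMax : ℝ
  /-- lower bound for realized demand -/
  demandMin : ℝ
  /-- initial inventories -/
  K : S → ℝ
  /-- nominal parameter values -/
  ξ₀ : S → ParamSpace t₀ t_f m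
  /-- magnitude of the uncertainty -/
  τ : ℝ
  /-- `h s t p ξ` is the demand observed by seller `s` at time `t` when the prices charged at
  that time are `p` and the parameter of seller `s` is realized as `ξ`. -/
  h : S → ℝ → (S → ℝ) → ParamSpace t₀ t_f m → ℝ
  t₀_nonneg : 0 ≤ t₀
  t₀_lt_t_f : t₀ < t_f
  priceMin_nonneg : 0 ≤ priceMin
  priceMax_pos : 0 < priceMax
  demandMin_pos : 0 < demandMin
  τ_pos : 0 < τ

namespace PricingModel

variable {S : Type*} {m : ℕ}

/-- Lebesgue measure on the horizon of the model. -/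
noncomputable abbrev μ (M : PricingModel S m) : Measure ℝ := horizonMeasure M.t₀ M.t_f

/-- Price paths and realized-demand paths of the model. -/
abbrev Path (M : PricingModel S m) : Type := PathSpace M.t₀ M.t_f

/-- Uncertain parameters of the model. -/
abbrev Param (M : PricingModel S m) : Type := ParamSpace M.t₀ M.t_f m

/-- The uncertainty set `U_s = {ξ_s⁰ + τ ψ : ‖ψ‖ ≤ 1}`. -/
def U (M : PricingModel S m) (s : S) : Set M.Param :=
  {ξ | ∃ ψ : M.Param, ‖ψ‖ ≤ 1 ∧ ξ = M.ξ₀ s + M.τ • ψ}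

/-- The price vectors that respect the price bounds. -/
def priceBox (M : PricingModel S m) : Set (S → ℝ) :=
  {p | ∀ r, p r ∈ Icc M.priceMin M.priceMax}

/-- A price path respects the price bounds. -/
def FeasiblePrice (M : PricingModel S m) (x : M.Path) : Prop :=
  ∀ᵐ t ∂M.μ, M.priceMin ≤ x t ∧ x t ≤ M.priceMax

/-- The observed demand path `t ↦ h_s(π(t); ξ)` of seller `s` for the price paths `π`. -/
noncomputable def demandPath (M : PricingModel S m) (s : S) (π : S → M.Path) (ξ : M.Param) :
    ℝ → ℝ :=
  fun t => M.h s t (fun r => π r t) ξ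

/-- `∇_ξ h_s(p; ξ)` at time `t`: the gradient, in the Hilbert space `(L²[t₀, t_f])^m`, of the
demand as a function of the parameter, which ranges over the uncertainty set. -/
noncomputable def demandGradient (M : PricingModel S m) (s : S) (t : ℝ) (p : S → ℝ)
    (ξ : M.Param) : M.Param :=
  gradientWithin (M.h s t p) (M.U s) ξ

/-- The standing regularity conditions on the demand functions. -/
structure Regular [DecidableEq S] (M : PricingModel S m) : Prop where
  /-- Demand paths generated by feasible price paths are square integrable. -/
  memLp : ∀ s, ∀ π : S → M.Path, (∀ r, M.FeasiblePrice (π r)) → ∀ ξ ∈ M.U s,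
    MemLp (M.demandPath s π ξ) 2 M.μ
  /-- Demand is continuous in the prices. -/
  continuousOn : ∀ s, ∀ t ∈ Icc M.t₀ M.t_f, ∀ ξ ∈ M.U s,
    ContinuousOn (fun p => M.h s t p ξ) M.priceBox
  /-- The largest demand at the maximal own price is zero. -/
  sup_priceMax : ∀ s, ∀ t ∈ Icc M.t₀ M.t_f,
    IsLUB {y | ∃ p ∈ M.priceBox, p s = M.priceMax ∧ ∃ ξ ∈ M.U s, y = M.h s t p ξ} 0
  /-- Demand is concave in the prices. -/
  concaveOn : ∀ s, ∀ t ∈ Icc M.t₀ M.t_f, ∀ ξ ∈ M.U s,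
    ConcaveOn ℝ M.priceBox (fun p => M.h s t p ξ)
  /-- Demand is strictly monotonically decreasing in own price. -/
  strictly_decreasing : ∀ s, ∀ π : S → M.Path, (∀ r ≠ s, M.FeasiblePrice (π r)) →
    ∀ ξ ∈ M.U s, ∀ x₁ x₂ : M.Path, M.FeasiblePrice x₁ → M.FeasiblePrice x₂ → x₁ ≠ x₂ →
    ∫ t, Real.exp (-t) * ((M.demandPath s (Function.update π s x₁) ξ t
      - M.demandPath s (Function.update π s x₂) ξ t) * (x₁ t - x₂ t)) ∂M.μ < 0
  /-- Demand is linear in the parameter: its second derivative in the parameter vanishes. -/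
  linear_param : ∀ s, ∀ t ∈ Icc M.t₀ M.t_f, ∀ p ∈ M.priceBox,
    ContDiffOn ℝ 2 (M.h s t p) (M.U s) ∧
    ∀ ξ ∈ M.U s, fderivWithin ℝ (fderivWithin ℝ (M.h s t p) (M.U s)) (M.U s) ξ = 0
  /-- The norm of the parameter gradient is monotone increasing in own price. -/
  gradient_monotone : ∀ s, ∀ t ∈ Icc M.t₀ M.t_f, ∀ p ∈ M.priceBox, ∀ ξ ∈ M.U s,
    MonotoneOn (fun x => ‖M.demandGradient s t (Function.update p s x) ξ‖)
      (Icc M.priceMin M.priceMax)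

/-- The robust strategy space of seller `s`: the pairs `(π_s, D_s)` of a price path and a
realized-demand path that satisfy the constraints of the robust best response problem, given
the prices of the competitors. Only the components `π r` with `r ≠ s` matter. -/
def robustStrategySpace [DecidableEq S] (M : PricingModel S m) (s : S) (π : S → M.Path) :
    Set (M.Path × M.Path) :=
  {v |
    (∀ᵐ t ∂M.μ,
      v.2 t - M.demandPath s (Function.update π s v.1) (M.ξ₀ s) t
        + M.τ * ‖M.demandGradient s t (fun r => Function.update π s v.1 r t) (M.ξ₀ s)‖ ≤ 0) ∧
    M.K s = ∫ t, v.2 t ∂M.μ ∧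
    (∀ᵐ t ∂M.μ, M.priceMin ≤ v.1 t) ∧
    (∀ᵐ t ∂M.μ, v.1 t ≤ M.priceMax) ∧
    (∀ᵐ t ∂M.μ, M.demandMin ≤ v.2 t)}

/-- The discounted revenue `J_s(π_s, D_s) = ∫ exp(-ρ t) π_s(t) D_s(t) dt`. -/
noncomputable def revenue (M : PricingModel S m) (v : M.Path × M.Path) : ℝ :=
  ∫ t, Real.exp (-M.ρ * t) * (v.1 t * v.2 t) ∂M.μ

/-- `v` solves the robust best response problem of seller `s` against the prices `π`. -/
def IsRobustBestResponse [DecidableEq S] (M : PricingModel S m) (s : S) (π : S → M.Path)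
    (v : M.Path × M.Path) : Prop :=
  v ∈ M.robustStrategySpace s π ∧ ∀ w ∈ M.robustStrategySpace s π, M.revenue w ≤ M.revenue v

end PricingModel

/-!
The objective is bilinear and not weakly upper semicontinuous in `(π_s, D_s)`. In the variables
`(z, d) = (π_s D_s, D_s)` it is linear, and so is the inventory constraint. The pointwise constraint
on demand becomes `d ≤ g (z / d)`, where `g` is the robust demand as a function of own price. Since
demand is affine in the parameter, `g` is the infimum of the demand over the ball of parameters;
hence it is concave and has a closed hypograph, and, because `d > 0`, the constraint set for
`(z, d)` is convex and closed. Concavity also bounds demand by a fixed `L²` path. So the feasible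
pairs `(z, d)` form a nonempty closed convex bounded set of a reflexive space, on which a continuous
linear functional attains its maximum, and `π_s = z / d` recovers the price.
-/

open Filter Bornology
open scoped Topology ENNReal

section Reflexive

variable {E G : Type*}

theorem surjective_inclusionInDoubleDual_of_completeSpace [NormedAddCommGroup E]
    [InnerProductSpace ℝ E] [CompleteSpace E] :
    Function.Surjective (NormedSpace.inclusionInDoubleDual ℝ E) := by
  intro φ
  let riesz := InnerProductSpace.toDual ℝ E
  refine ⟨riesz.symm (φ ∘L riesz.toContinuousLinearEquiv.toContinuousLinearMap), ?_⟩
  ext f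
  obtain ⟨y, rfl⟩ := riesz.surjective f
  rw [NormedSpace.dual_def, InnerProductSpace.toDual_apply_apply, real_inner_comm,
    InnerProductSpace.toDual_symm_apply]
  rfl

theorem surjective_inclusionInDoubleDual_prod {𝕜 : Type*} [NontriviallyNormedField 𝕜]
    [NormedAddCommGroup E] [NormedSpace 𝕜 E] [NormedAddCommGroup G] [NormedSpace 𝕜 G]
    (hE : Function.Surjective (NormedSpace.inclusionInDoubleDual 𝕜 E))
    (hG : Function.Surjective (NormedSpace.inclusionInDoubleDual 𝕜 G)) :
    Function.Surjective (NormedSpace.inclusionInDoubleDual 𝕜 (E × G)) := by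
  intro φ
  obtain ⟨x, hx⟩ := hE (φ ∘L
    (ContinuousLinearMap.compL 𝕜 (E × G) E 𝕜).flip (ContinuousLinearMap.fst 𝕜 E G))
  obtain ⟨y, hy⟩ := hG (φ ∘L
    (ContinuousLinearMap.compL 𝕜 (E × G) G 𝕜).flip (ContinuousLinearMap.snd 𝕜 E G))
  refine ⟨(x, y), ContinuousLinearMap.ext fun f => ?_⟩
  have hfx := DFunLike.congr_fun hx (f ∘L ContinuousLinearMap.inl 𝕜 E G)
  have hfy := DFunLike.congr_fun hy (f ∘L ContinuousLinearMap.inr 𝕜 E G)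
  rw [NormedSpace.dual_def] at hfx hfy ⊢
  calc f (x, y) = f (x, 0) + f (0, y) := by rw [← map_add, Prod.mk_add_mk, add_zero, zero_add]
    _ = φ ((f ∘L .inl 𝕜 E G) ∘L .fst 𝕜 E G) + φ ((f ∘L .inr 𝕜 E G) ∘L .snd 𝕜 E G) :=
      congrArg₂ (· + ·) hfx hfy
    _ = φ f := by
      rw [← map_add]
      congr 1
      ext p <;> simp [← Prod.zero_eq_mk]

variable [NormedAddCommGroup E] [NormedSpace ℝ E]

theorem isCompact_toWeakSpace_image
    (hE : Function.Surjective (NormedSpace.inclusionInDoubleDual ℝ E)) {A : Set E}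
    (hclosed : IsClosed A) (hconv : Convex ℝ A) (hbdd : IsBounded A) :
    IsCompact (toWeakSpace ℝ E '' A) := by
  rw [← hclosed.closure_eq, hconv.toWeakSpace_closure ℝ]
  refine NormedSpace.isCompact_closure_of_isBounded ℝ E _ ?_ ?_
  · rwa [preimage_image_eq _ (toWeakSpace ℝ E).injective]
  · have hsurj : Function.Surjective (NormedSpace.inclusionInDoubleDualWeak ℝ E) :=
      fun φ => (hE φ).imp' (toWeakSpace ℝ E) fun _ hx => hx
    exact fun φ _ => hsurj φ

theorem exists_isMaxOn_of_isClosed_of_convex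
    (hE : Function.Surjective (NormedSpace.inclusionInDoubleDual ℝ E)) (f : E →L[ℝ] ℝ) {A : Set E}
    (hne : A.Nonempty) (hclosed : IsClosed A) (hconv : Convex ℝ A) (hbdd : IsBounded A) :
    ∃ x ∈ A, IsMaxOn f A x := by
  have hf : Continuous fun x : WeakSpace ℝ E => f ((toWeakSpace ℝ E).symm x) :=
    WeakBilin.eval_continuous (topDualPairing ℝ E).flip f
  obtain ⟨_, ⟨x, hx, rfl⟩, hmax⟩ :=
    (isCompact_toWeakSpace_image hE hclosed hconv hbdd).exists_isMaxOn (hne.image _)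
      hf.continuousOn
  refine ⟨x, hx, fun y hy => ?_⟩
  simpa using hmax (mem_image_of_mem _ hy)

end Reflexive

section Affine

theorem eqOn_add_fderivWithin_of_fderivWithin_fderivWithin_eq_zero {E F : Type*}
    [NormedAddCommGroup E] [NormedSpace ℝ E] [NormedAddCommGroup F] [NormedSpace ℝ F] {f : E → F}
    {s : Set E} (hs : Convex ℝ s) (hs' : UniqueDiffOn ℝ s) (hf : DifferentiableOn ℝ f s)
    (hf' : DifferentiableOn ℝ (fderivWithin ℝ f s) s)
    (h0 : ∀ x ∈ s, fderivWithin ℝ (fderivWithin ℝ f s) s x = 0) {x : E} (hx : x ∈ s) :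
    EqOn f (fun y => f x + fderivWithin ℝ f s x (y - x)) s := by
  refine hs.eqOn_of_fderivWithin_eq hf (by fun_prop) hs' (fun y hy => ?_) hx (by simp)
  have hlin : HasFDerivAt (fun y => fderivWithin ℝ f s x (y - x)) (fderivWithin ℝ f s x) y :=
    (fderivWithin ℝ f s x).hasFDerivAt.comp y ((hasFDerivAt_id y).sub_const x)
  rw [hs.is_const_of_fderivWithin_eq_zero hf' h0 hy hx, fderivWithin_const_add,
    hlin.hasFDerivWithinAt.fderivWithin (hs' y hy)]

variable {E : Type*} [NormedAddCommGroup E] [InnerProductSpace ℝ E]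

theorem isLeast_inner_sub_image_closedBall (g x : E) {r : ℝ} (hr : 0 ≤ r) :
    IsLeast ((fun y => inner ℝ g (y - x)) '' Metric.closedBall x r) (-(r * ‖g‖)) := by
  constructor
  · refine ⟨x - (r * ‖g‖⁻¹) • g, ?_, ?_⟩
    · rw [Metric.mem_closedBall, dist_eq_norm, sub_sub_cancel_left, norm_neg, norm_smul,
        Real.norm_of_nonneg (by positivity), mul_assoc]
      exact mul_le_of_le_one_right hr (inv_mul_le_one_of_le₀ le_rfl (norm_nonneg g))
    · simp only [sub_sub_cancel_left, inner_neg_right, inner_smul_right, real_inner_self_eq_norm_sq]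
      rcases eq_or_ne ‖g‖ 0 with h | h
      · simp [h]
      · field_simp
  · rintro _ ⟨y, hy, rfl⟩
    rw [Metric.mem_closedBall, dist_eq_norm] at hy
    calc -(r * ‖g‖) ≤ -(‖g‖ * ‖y - x‖) := by rw [mul_comm]; gcongr
      _ ≤ inner ℝ g (y - x) := neg_le_of_abs_le (abs_real_inner_le_norm _ _)

theorem isGLB_image_closedBall_of_fderivWithin_fderivWithin_eq_zero [CompleteSpace E] {f : E → ℝ}
    {x : E} {r : ℝ} (hr : 0 < r) (hf : ContDiffOn ℝ 2 f (Metric.closedBall x r))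
    (h0 : ∀ y ∈ Metric.closedBall x r, fderivWithin ℝ
      (fderivWithin ℝ f (Metric.closedBall x r)) (Metric.closedBall x r) y = 0) :
    IsGLB (f '' Metric.closedBall x r)
      (f x - r * ‖gradientWithin f (Metric.closedBall x r) x‖) := by
  set s := Metric.closedBall x r
  have hs : Convex ℝ s := convex_closedBall x r
  have hs' : UniqueDiffOn ℝ s := uniqueDiffOn_convex hs
    ⟨x, Metric.ball_subset_interior_closedBall (Metric.mem_ball_self hr)⟩
  have haff : EqOn f (fun y => f x + inner ℝ (gradientWithin f s x) (y - x)) s := by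
    simp only [inner_gradientWithin_left]
    exact eqOn_add_fderivWithin_of_fderivWithin_fderivWithin_eq_zero hs hs'
      (hf.differentiableOn two_ne_zero)
      ((hf.fderivWithin hs' (m := 1) one_add_one_eq_two.le).differentiableOn one_ne_zero) h0
      (Metric.mem_closedBall_self hr.le)
  rw [haff.image_eq, sub_eq_add_neg]
  have hglb := (OrderIso.addLeft (f x)).isGLB_image'.2
    (isLeast_inner_sub_image_closedBall (gradientWithin f s x) x hr.le).isGLB
  rwa [image_image] at hglb

end Affine

section Hypograph

variable {E ι : Type*} {I : Set ι} {s : Set E} {f : ι → E → ℝ} {g : E → ℝ}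

theorem concaveOn_of_isGLB [AddCommGroup E] [Module ℝ E] (hs : Convex ℝ s)
    (hf : ∀ i ∈ I, ConcaveOn ℝ s (f i))
    (hg : ∀ x ∈ s, IsGLB ((fun i => f i x) '' I) (g x)) : ConcaveOn ℝ s g := by
  refine ⟨hs, fun x hx y hy a b ha hb hab => (le_isGLB_iff (hg _ (hs hx hy ha hb hab))).2 ?_⟩
  rintro _ ⟨i, hi, rfl⟩
  calc a • g x + b • g y ≤ a • f i x + b • f i y := by
        gcongr
        · exact (hg x hx).1 (mem_image_of_mem _ hi)
        · exact (hg y hy).1 (mem_image_of_mem _ hi)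
    _ ≤ f i (a • x + b • y) := (hf i hi).2 hx hy ha hb hab

theorem isClosed_hypograph_of_isGLB [TopologicalSpace E] (hs : IsClosed s)
    (hf : ∀ i ∈ I, ContinuousOn (f i) s)
    (hg : ∀ x ∈ s, IsGLB ((fun i => f i x) '' I) (g x)) :
    IsClosed {p : E × ℝ | p.1 ∈ s ∧ p.2 ≤ g p.1} := by
  have hinter : {p : E × ℝ | p.1 ∈ s ∧ p.2 ≤ g p.1} =
      Prod.fst ⁻¹' s ∩ ⋂ i ∈ I, {p | p.1 ∈ s ∧ p.2 ≤ f i p.1} := by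
    ext p
    simp only [mem_ofPred_eq, mem_inter_iff, mem_preimage, mem_iInter, and_congr_right_iff]
    intro hp
    rw [le_isGLB_iff (hg _ hp)]
    simp [lowerBounds, hp]
  rw [hinter]
  exact (hs.preimage continuous_fst).inter
    (isClosed_biInter fun i hi => hs.hypograph (hf i hi))

theorem le_two_mul_midpoint_sub_min_of_concaveOn {f : ℝ → ℝ} {a b x : ℝ}
    (hf : ConcaveOn ℝ (Icc a b) f) (hx : x ∈ Icc a b) :
    f x ≤ 2 * f (midpoint ℝ a b) - min (f a) (f b) := by
  have hab : a ≤ b := hx.1.trans hx.2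
  have hx' : a + b - x ∈ Icc a b := ⟨by linarith [hx.2], by linarith [hx.1]⟩
  have hmin : min (f a) (f b) ≤ f (a + b - x) :=
    hf.min_le_of_mem_Icc (left_mem_Icc.2 hab) (right_mem_Icc.2 hab) hx'
  have hmid : (2⁻¹ : ℝ) * f x + 2⁻¹ * f (a + b - x) ≤ f (midpoint ℝ a b) := by
    have heq : midpoint ℝ a b = (2⁻¹ : ℝ) • x + (2⁻¹ : ℝ) • (a + b - x) := by
      simp only [midpoint_eq_smul_add, invOf_eq_inv, smul_eq_mul]
      ring
    rw [heq]
    exact hf.2 hx hx' (by norm_num) (by norm_num) (by norm_num)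
  linarith

end Hypograph

section RevenueRegion

variable {E : Type*} [AddCommGroup E] [Module ℝ E] {s : Set E} {δ : ℝ} {g : E → ℝ}

/-- The pairs `(x, d)` of a price in `s` and a demand between the floor `δ` and the demand
`g x` observed at that price. -/
def priceDemandRegion (s : Set E) (δ : ℝ) (g : E → ℝ) : Set (E × ℝ) :=
  {p | p.1 ∈ s ∧ δ ≤ p.2 ∧ p.2 ≤ g p.1}

/-- The pairs `(d • x, d)` of a revenue rate and a demand for which the price-demand pair `(x, d)`
lies in `C`. The price is recovered as `d⁻¹ • (d • x)`, so this is meaningful only where the demand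
is nonzero. -/
def revenueRegion (C : Set (E × ℝ)) : Set (E × ℝ) :=
  {p | (p.2⁻¹ • p.1, p.2) ∈ C}

-- The price of a mixture is the demand-weighted mean of the prices, with weights `a * d / D` and
-- `b * e / D`; concavity bounds `g` there below by the demand-weighted mean of `d` and `e`, which
-- is at least their plain mean `D`.
theorem convex_revenueRegion (hδ : 0 < δ) (hg : ConcaveOn ℝ s g) :
    Convex ℝ (revenueRegion (priceDemandRegion s δ g)) := by
  rintro ⟨z, d⟩ ⟨hz, hδd, hdg⟩ ⟨y, e⟩ ⟨hy, hδe, heg⟩ a b ha hb hab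
  dsimp only at hz hδd hdg hy hδe heg
  have hd : 0 < d := hδ.trans_le hδd
  have he : 0 < e := hδ.trans_le hδe
  set D := a * d + b * e with hD
  have hδD : δ ≤ D :=
    calc δ = a * δ + b * δ := by rw [← add_mul, hab, one_mul]
      _ ≤ D := by rw [hD]; gcongr
  have hDpos : 0 < D := hδ.trans_le hδD
  have hsum : a * d / D + b * e / D = 1 := by rw [← add_div, div_self hDpos.ne']
  have hprice : D⁻¹ • (a • z + b • y) =
      (a * d / D) • d⁻¹ • z + (b * e / D) • e⁻¹ • y := by
    simp only [smul_add, smul_smul]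
    congr 2 <;> field_simp
  have hmean : D ≤ a * d / D * d + b * e / D * e := by
    have hsq : D ^ 2 ≤ a * d ^ 2 + b * e ^ 2 :=
      (convexOn_pow 2).2 hd.le he.le ha hb hab
    calc D = D ^ 2 / D := by field_simp
      _ ≤ (a * d ^ 2 + b * e ^ 2) / D := by gcongr
      _ = a * d / D * d + b * e / D * e := by ring
  change D⁻¹ • (a • z + b • y) ∈ s ∧ δ ≤ D ∧ D ≤ g (D⁻¹ • (a • z + b • y))
  rw [hprice]
  have hα : 0 ≤ a * d / D := by positivity
  have hβ : 0 ≤ b * e / D := by positivity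
  refine ⟨hg.1 hz hy hα hβ hsum, hδD, ?_⟩
  calc D ≤ a * d / D * d + b * e / D * e := hmean
    _ ≤ a * d / D * g (d⁻¹ • z) + b * e / D * g (e⁻¹ • y) := by gcongr
    _ ≤ g ((a * d / D) • d⁻¹ • z + (b * e / D) • e⁻¹ • y) := hg.2 hz hy hα hβ hsum

variable [TopologicalSpace E] [ContinuousSMul ℝ E]

theorem isClosed_revenueRegion (hδ : 0 < δ) (hg : IsClosed {p : E × ℝ | p.1 ∈ s ∧ p.2 ≤ g p.1}) :
    IsClosed (revenueRegion (priceDemandRegion s δ g)) := by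
  have hprice : ContinuousOn (fun p : E × ℝ => (p.2⁻¹ • p.1, p.2)) {p | δ ≤ p.2} :=
    ((continuousOn_snd.inv₀ fun p hp => (hδ.trans_le hp).ne').smul continuousOn_fst).prodMk
      continuousOn_snd
  convert hprice.preimage_isClosed_of_isClosed (isClosed_le continuous_const continuous_snd) hg
    using 1
  ext p
  exact and_left_comm

end RevenueRegion

section AESelections

variable {α : Type*} {mα : MeasurableSpace α} {μ : Measure α}

section Prod

variable {E F : Type*} [NormedAddCommGroup E] [NormedAddCommGroup F] {p q : ℝ≥0∞}
  {C : α → Set (E × F)}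

theorem isClosed_setOf_ae_prodMk_mem [Fact (1 ≤ p)] [Fact (1 ≤ q)]
    (hC : ∀ᵐ t ∂μ, IsClosed (C t)) :
    IsClosed {v : Lp E p μ × Lp F q μ | ∀ᵐ t ∂μ, (v.1 t, v.2 t) ∈ C t} := by
  refine IsSeqClosed.isClosed fun u v hu huv => ?_
  have hfst : Tendsto (fun n => (u n).1) atTop (𝓝 v.1) := (continuous_fst.tendsto v).comp huv
  have hsnd : Tendsto (fun n => (u n).2) atTop (𝓝 v.2) := (continuous_snd.tendsto v).comp huv
  obtain ⟨φ, hφ, hφ_lim⟩ := (tendstoInMeasure_of_tendsto_Lp hfst).exists_seq_tendsto_ae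
  obtain ⟨χ, hχ, hχ_lim⟩ :=
    (tendstoInMeasure_of_tendsto_Lp (hsnd.comp hφ.tendsto_atTop)).exists_seq_tendsto_ae
  filter_upwards [hC, hφ_lim, hχ_lim, ae_all_iff.2 hu] with t hCt hlim₁ hlim₂ hmem
  exact hCt.mem_of_tendsto ((hlim₁.comp hχ.tendsto_atTop).prodMk_nhds hlim₂)
    (Eventually.of_forall fun n => hmem (φ (χ n)))

theorem convex_setOf_ae_prodMk_mem [NormedSpace ℝ E] [NormedSpace ℝ F]
    (hC : ∀ᵐ t ∂μ, Convex ℝ (C t)) :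
    Convex ℝ {v : Lp E p μ × Lp F q μ | ∀ᵐ t ∂μ, (v.1 t, v.2 t) ∈ C t} := by
  intro u hu v hv a b ha hb hab
  filter_upwards [hC, hu, hv, Lp.coeFn_add (a • u.1) (b • v.1), Lp.coeFn_add (a • u.2) (b • v.2),
    Lp.coeFn_smul a u.1, Lp.coeFn_smul b v.1, Lp.coeFn_smul a u.2, Lp.coeFn_smul b v.2]
    with t hCt hut hvt hadd₁ hadd₂ hau₁ hbv₁ hau₂ hbv₂
  have hfst : (a • u + b • v).1 t = a • u.1 t + b • v.1 t :=
    hadd₁.trans (congrArg₂ (· + ·) hau₁ hbv₁)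
  have hsnd : (a • u + b • v).2 t = a • u.2 t + b • v.2 t :=
    hadd₂.trans (congrArg₂ (· + ·) hau₂ hbv₂)
  rw [hfst, hsnd]
  exact hCt hut hvt ha hb hab

theorem isBounded_setOf_ae_prodMk_mem [Fact (1 ≤ p)] {H : α → ℝ} (hH : MemLp H p μ)
    (hCH : ∀ᵐ t ∂μ, ∀ x ∈ C t, ‖x‖ ≤ H t) :
    IsBounded {v : Lp E p μ × Lp F p μ | ∀ᵐ t ∂μ, (v.1 t, v.2 t) ∈ C t} := by
  refine isBounded_iff_forall_norm_le.2 ⟨‖hH.toLp‖, fun v hv => norm_prod_le_iff.2 ?_⟩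
  have hvH : ∀ᵐ t ∂μ, ‖(v.1 t, v.2 t)‖ ≤ ‖hH.toLp H t‖ := by
    filter_upwards [hCH, hv, hH.coeFn_toLp] with t hCt hvt hHt
    rw [hHt]
    exact (hCt _ hvt).trans (le_abs_self _)
  exact ⟨Lp.norm_le_norm_of_ae_le (hvH.mono fun t => (norm_fst_le _).trans),
    Lp.norm_le_norm_of_ae_le (hvH.mono fun t => (norm_snd_le _).trans)⟩

end Prod

theorem innerSL_toLp_apply_eq_integral {w : α → ℝ} (hw : MemLp w 2 μ) (d : Lp ℝ 2 μ) :
    innerSL ℝ hw.toLp d = ∫ t, w t * d t ∂μ := by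
  rw [innerSL_apply_apply, L2.inner_def]
  refine integral_congr_ae ?_
  filter_upwards [hw.coeFn_toLp] with t ht
  rw [ht]
  exact mul_comm _ _

theorem memLp_restrict_of_continuousOn {X E : Type*} [TopologicalSpace X] [T2Space X]
    [MeasurableSpace X] [OpensMeasurableSpace X] {ν : Measure X} [IsFiniteMeasureOnCompacts ν]
    [NormedAddCommGroup E] {K : Set X} {f : X → E} {p : ℝ≥0∞} (hK : IsCompact K)
    (hf : ContinuousOn f K) : MemLp f p (ν.restrict K) := by
  have : IsFiniteMeasure (ν.restrict K) := isFiniteMeasure_restrict.2 hK.measure_ne_top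
  obtain ⟨c, hc⟩ := hK.exists_bound_of_continuousOn hf
  exact MemLp.of_bound (hf.aestronglyMeasurable_of_isCompact hK hK.measurableSet) c
    (ae_restrict_of_forall_mem hK.measurableSet hc)

/-- The pairs of `L²` functions with values in the sets `C t` and with second component of
integral `k`: the price and demand paths obeying pointwise constraints and selling the inventory
`k`. -/
def integralSelections (μ : Measure α) (C : α → Set (ℝ × ℝ)) (k : ℝ) :
    Set (Lp ℝ 2 μ × Lp ℝ 2 μ) :=
  {v | (∀ᵐ t ∂μ, (v.1 t, v.2 t) ∈ C t) ∧ ∫ t, v.2 t ∂μ = k}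

variable {C : α → Set (ℝ × ℝ)} {k b : ℝ}

theorem exists_mem_integralSelections_revenueRegion
    (hC : ∀ᵐ t ∂μ, ∀ x ∈ C t, |x.1| ≤ b ∧ x.2 ≠ 0) {v : Lp ℝ 2 μ × Lp ℝ 2 μ}
    (hv : v ∈ integralSelections μ C k) :
    ∃ u ∈ integralSelections μ (fun t => revenueRegion (C t)) k,
      ∀ᵐ t ∂μ, u.1 t = v.1 t * v.2 t := by
  have hmul : MemLp (fun t => v.1 t * v.2 t) 2 μ := by
    refine (Lp.memLp v.2).of_le_mul (c := b)
      ((Lp.aestronglyMeasurable v.1).mul (Lp.aestronglyMeasurable v.2)) ?_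
    filter_upwards [hC, hv.1] with t hCt hvt
    rw [norm_mul]
    gcongr
    exact (hCt _ hvt).1
  refine ⟨(hmul.toLp, v.2), ⟨?_, hv.2⟩, hmul.coeFn_toLp⟩
  filter_upwards [hC, hv.1, hmul.coeFn_toLp] with t hCt hvt hmult
  change ((v.2 t)⁻¹ * hmul.toLp _ t, v.2 t) ∈ C t
  rwa [hmult, mul_comm, mul_inv_cancel_right₀ (hCt _ hvt).2]

variable [IsFiniteMeasure μ]

theorem exists_mem_integralSelections_of_revenueRegion
    (hC : ∀ᵐ t ∂μ, ∀ x ∈ C t, |x.1| ≤ b ∧ x.2 ≠ 0) {u : Lp ℝ 2 μ × Lp ℝ 2 μ}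
    (hu : u ∈ integralSelections μ (fun t => revenueRegion (C t)) k) :
    ∃ v ∈ integralSelections μ C k, ∀ᵐ t ∂μ, u.1 t = v.1 t * v.2 t := by
  have hdiv : MemLp (fun t => (u.2 t)⁻¹ * u.1 t) 2 μ := by
    refine MemLp.of_bound ((Lp.aestronglyMeasurable u.2).aemeasurable.inv.aestronglyMeasurable.mul
      (Lp.aestronglyMeasurable u.1)) b ?_
    filter_upwards [hC, hu.1] with t hCt hut using (hCt _ hut).1
  refine ⟨(hdiv.toLp, u.2), ⟨?_, hu.2⟩, ?_⟩
  · filter_upwards [hu.1, hdiv.coeFn_toLp] with t hut hdivt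
    rwa [hdivt]
  · filter_upwards [hC, hu.1, hdiv.coeFn_toLp] with t hCt hut hdivt
    rw [hdivt, mul_comm, mul_inv_cancel_left₀ (hCt _ hut).2]

variable {w H : α → ℝ}

theorem exists_isMaxOn_integral_mul_fst (hw : MemLp w 2 μ) (hclosed : ∀ᵐ t ∂μ, IsClosed (C t))
    (hconv : ∀ᵐ t ∂μ, Convex ℝ (C t)) (hH : MemLp H 2 μ)
    (hCH : ∀ᵐ t ∂μ, ∀ x ∈ C t, ‖x‖ ≤ H t) (hne : (integralSelections μ C k).Nonempty) :
    ∃ v ∈ integralSelections μ C k,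
      IsMaxOn (fun v => ∫ t, w t * v.1 t ∂μ) (integralSelections μ C k) v := by
  have hone : MemLp (fun _ : α => (1 : ℝ)) 2 μ := memLp_const 1
  let total := innerSL ℝ hone.toLp ∘L ContinuousLinearMap.snd ℝ (Lp ℝ 2 μ) (Lp ℝ 2 μ)
  have htotal : ∀ v, total v = ∫ t, v.2 t ∂μ := fun v =>
    (innerSL_toLp_apply_eq_integral hone v.2).trans (by simp only [one_mul])
  have hset : integralSelections μ C k =
      {v | ∀ᵐ t ∂μ, (v.1 t, v.2 t) ∈ C t} ∩ total ⁻¹' {k} := by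
    ext v
    rw [mem_inter_iff, mem_preimage, mem_singleton_iff, htotal]
    rfl
  obtain ⟨v, hv, hmax⟩ := exists_isMaxOn_of_isClosed_of_convex
    (surjective_inclusionInDoubleDual_prod surjective_inclusionInDoubleDual_of_completeSpace
      surjective_inclusionInDoubleDual_of_completeSpace)
    (innerSL ℝ hw.toLp ∘L ContinuousLinearMap.fst ℝ (Lp ℝ 2 μ) (Lp ℝ 2 μ)) hne
    (hset ▸ (isClosed_setOf_ae_prodMk_mem hclosed).inter
      (isClosed_singleton.preimage total.continuous))
    (hset ▸ (convex_setOf_ae_prodMk_mem hconv).inter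
      ((convex_singleton k).linear_preimage total.toLinearMap))
    (hset ▸ (isBounded_setOf_ae_prodMk_mem hH hCH).subset inter_subset_left)
  refine ⟨v, hv, fun u hu => ?_⟩
  simpa only [mem_ofPred_eq, ContinuousLinearMap.comp_apply, ContinuousLinearMap.coe_fst',
    innerSL_toLp_apply_eq_integral] using hmax hu

theorem exists_isMaxOn_integral_mul_mul (hw : MemLp w 2 μ)
    (hclosed : ∀ᵐ t ∂μ, IsClosed (revenueRegion (C t)))
    (hconv : ∀ᵐ t ∂μ, Convex ℝ (revenueRegion (C t))) (hH : MemLp H 2 μ)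
    (hC : ∀ᵐ t ∂μ, ∀ x ∈ C t, |x.1| ≤ b ∧ 0 < x.2 ∧ x.2 ≤ H t)
    (hne : (integralSelections μ C k).Nonempty) :
    ∃ v ∈ integralSelections μ C k,
      IsMaxOn (fun v => ∫ t, w t * (v.1 t * v.2 t) ∂μ) (integralSelections μ C k) v := by
  have hC' : ∀ᵐ t ∂μ, ∀ x ∈ C t, |x.1| ≤ b ∧ x.2 ≠ 0 :=
    hC.mono fun t ht x hx => ⟨(ht x hx).1, (ht x hx).2.1.ne'⟩
  have hbound : ∀ᵐ t ∂μ, ∀ x ∈ revenueRegion (C t), ‖x‖ ≤ max b 1 * H t := by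
    filter_upwards [hC] with t ht x hx
    obtain ⟨hprice, hpos, hxH⟩ := ht _ hx
    have hle : ∀ c ≤ max b 1, c * x.2 ≤ max b 1 * H t := fun c hc => by gcongr
    refine norm_prod_le_iff.2 ⟨?_, ?_⟩
    · rw [smul_eq_mul, abs_mul, abs_inv, abs_of_pos hpos, inv_mul_le_iff₀ hpos, mul_comm] at hprice
      exact hprice.trans (hle b (le_max_left _ _))
    · rw [Real.norm_of_nonneg hpos.le, ← one_mul x.2]
      exact hle 1 (le_max_right _ _)
  obtain ⟨v₀, hv₀⟩ := hne
  obtain ⟨u₀, hu₀, -⟩ := exists_mem_integralSelections_revenueRegion hC' hv₀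
  obtain ⟨u, hu, hmax⟩ := exists_isMaxOn_integral_mul_fst hw hclosed hconv
    (hH.const_mul (max b 1)) hbound ⟨u₀, hu₀⟩
  obtain ⟨v, hv, huv⟩ := exists_mem_integralSelections_of_revenueRegion hC' hu
  refine ⟨v, hv, fun v' hv' => ?_⟩
  obtain ⟨u', hu', huv'⟩ := exists_mem_integralSelections_revenueRegion hC' hv'
  calc ∫ t, w t * (v'.1 t * v'.2 t) ∂μ = ∫ t, w t * u'.1 t ∂μ :=
        integral_congr_ae (huv'.mono fun t ht => by simp only [ht])
    _ ≤ ∫ t, w t * u.1 t ∂μ := hmax hu'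
    _ = ∫ t, w t * (v.1 t * v.2 t) ∂μ :=
        integral_congr_ae (huv.mono fun t ht => by simp only [ht])

end AESelections

namespace PricingModel

variable {S : Type*} {m : ℕ} (M : PricingModel S m) {s : S} {t : ℝ}

/-- Demand of seller `s` at time `t` and prices `p` is linear in the uncertain parameter,
assumption (A5) of the model. -/
def LinearInParam (s : S) (t : ℝ) (p : S → ℝ) : Prop :=
  ContDiffOn ℝ 2 (M.h s t p) (M.U s) ∧
    ∀ ξ ∈ M.U s, fderivWithin ℝ (fderivWithin ℝ (M.h s t p) (M.U s)) (M.U s) ξ = 0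

/-- The robust counterpart of the demand: the right-hand side of the constraint on realized
demand in the robust best response problem. -/
noncomputable def robustDemand (s : S) (t : ℝ) (p : S → ℝ) : ℝ :=
  M.h s t p (M.ξ₀ s) - M.τ * ‖M.demandGradient s t p (M.ξ₀ s)‖

theorem U_eq_closedBall (s : S) : M.U s = Metric.closedBall (M.ξ₀ s) M.τ := by
  rw [← affinity_unitClosedBall M.τ_pos.le]
  ext ξ
  simp only [mem_vadd_set, mem_smul_set, exists_exists_and_eq_and, mem_closedBall_zero_iff,
    vadd_eq_add]
  exact exists_congr fun ψ => and_congr_right fun _ => eq_comm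

theorem nominal_mem_U (s : S) : M.ξ₀ s ∈ M.U s :=
  ⟨0, by simp⟩

variable {M} in
theorem LinearInParam.isGLB_robustDemand {p : S → ℝ} (h : M.LinearInParam s t p) :
    IsGLB (M.h s t p '' M.U s) (M.robustDemand s t p) := by
  obtain ⟨hcont, hderiv⟩ := h
  rw [robustDemand, demandGradient]
  rw [U_eq_closedBall] at hcont hderiv ⊢
  exact isGLB_image_closedBall_of_fderivWithin_fderivWithin_eq_zero M.τ_pos hcont hderiv

theorem robustDemand_le (s : S) (t : ℝ) (p : S → ℝ) :
    M.robustDemand s t p ≤ M.h s t p (M.ξ₀ s) :=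
  sub_le_self _ (mul_nonneg M.τ_pos.le (norm_nonneg _))

theorem memLp_discount : MemLp (fun t => Real.exp (-M.ρ * t)) 2 M.μ :=
  memLp_restrict_of_continuousOn isCompact_Icc (by fun_prop)

variable {M} in
theorem FeasiblePrice.priceMin_le_priceMax {x : M.Path} (hx : M.FeasiblePrice x) :
    M.priceMin ≤ M.priceMax := by
  have : (ae M.μ).NeBot := ae_restrict_neBot.2 (by simp [M.t₀_lt_t_f])
  obtain ⟨t, hmin, hmax⟩ := hx.exists
  exact hmin.trans hmax

theorem ae_mem_priceBox [Countable S] {π : S → M.Path} (hπ : ∀ r, M.FeasiblePrice (π r)) :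
    ∀ᵐ t ∂M.μ, (fun r => π r t) ∈ M.priceBox :=
  ae_all_iff.2 hπ

variable [DecidableEq S]

theorem update_mem_priceBox {p : S → ℝ} (hp : p ∈ M.priceBox) (s : S) {x : ℝ}
    (hx : x ∈ Icc M.priceMin M.priceMax) : Function.update p s x ∈ M.priceBox :=
  (Function.forall_update_iff p fun _ y => y ∈ Icc M.priceMin M.priceMax).2 ⟨hx, fun r _ => hp r⟩

/-- The pointwise constraints of the robust best response problem: the price-demand pairs that
seller `s` may choose at time `t`. -/
def strategyRegion (s : S) (π : S → M.Path) (t : ℝ) : Set (ℝ × ℝ) :=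
  priceDemandRegion (Icc M.priceMin M.priceMax) M.demandMin fun x =>
    M.robustDemand s t (Function.update (fun r => π r t) s x)

theorem update_path_apply (π : S → M.Path) (s : S) (x : M.Path) (t : ℝ) :
    (fun r => Function.update π s x r t) = Function.update (fun r => π r t) s (x t) :=
  funext fun r => Function.apply_update (fun _ (y : M.Path) => y t) π s x r

theorem robustStrategySpace_eq_integralSelections (s : S) (π : S → M.Path) :
    M.robustStrategySpace s π = integralSelections M.μ (M.strategyRegion s π) (M.K s) := by
  ext v
  simp only [robustStrategySpace, integralSelections, strategyRegion, priceDemandRegion,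
    demandPath, update_path_apply, robustDemand, mem_ofPred_eq, mem_Icc, eventually_and,
    le_sub_iff_add_le, sub_add, sub_nonpos, eq_comm (a := M.K s)]
  tauto

theorem robustStrategySpace_update (s : S) (π : S → M.Path) (x : M.Path) :
    M.robustStrategySpace s (Function.update π s x) = M.robustStrategySpace s π := by
  simp only [robustStrategySpace, Function.update_idem]

theorem memLp_demand_update {π : S → M.Path} (hπ : ∀ r, M.FeasiblePrice (π r))
    (hmem : ∀ π : S → M.Path, (∀ r, M.FeasiblePrice (π r)) →
      MemLp (M.demandPath s π (M.ξ₀ s)) 2 M.μ) {c : ℝ} (hc : c ∈ Icc M.priceMin M.priceMax) :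
    MemLp (fun t => M.h s t (Function.update (fun r => π r t) s c) (M.ξ₀ s)) 2 M.μ := by
  have hconst : ∀ᵐ t ∂M.μ, Lp.const 2 M.μ c t = c := Lp.coeFn_const 2 M.μ c
  have hfeas : ∀ r, M.FeasiblePrice (Function.update π s (Lp.const 2 M.μ c) r) :=
    (Function.forall_update_iff π fun _ x => M.FeasiblePrice x).2
      ⟨hconst.mono fun t ht => ht.symm ▸ hc, fun r _ => hπ r⟩
  refine (memLp_congr_ae ?_).1 (hmem _ hfeas)
  filter_upwards [hconst] with t ht
  rw [demandPath, update_path_apply, ht]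

/-- The upper bound for the demand of seller `s` at time `t`, over all own prices, that concavity
in own price yields from the demands at the two price bounds and at their midpoint. -/
noncomputable def demandBound (s : S) (π : S → M.Path) (t : ℝ) : ℝ :=
  let demand := fun c => M.h s t (Function.update (fun r => π r t) s c) (M.ξ₀ s)
  2 * demand (midpoint ℝ M.priceMin M.priceMax) - min (demand M.priceMin) (demand M.priceMax)

theorem memLp_demandBound {π : S → M.Path} (hπ : ∀ r, M.FeasiblePrice (π r))
    (hmem : ∀ π : S → M.Path, (∀ r, M.FeasiblePrice (π r)) →
      MemLp (M.demandPath s π (M.ξ₀ s)) 2 M.μ) :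
    MemLp (M.demandBound s π) 2 M.μ := by
  have hmin := left_mem_Icc.2 (hπ s).priceMin_le_priceMax
  have hmax := right_mem_Icc.2 (hπ s).priceMin_le_priceMax
  have hmid := (convex_Icc (𝕜 := ℝ) M.priceMin M.priceMax).midpoint_mem hmin hmax
  exact ((M.memLp_demand_update hπ hmem hmid).const_mul 2).sub
    ((M.memLp_demand_update hπ hmem hmin).inf (M.memLp_demand_update hπ hmem hmax))

theorem strategyRegion_bounds {π : S → M.Path}
    (hconc : ConcaveOn ℝ (Icc M.priceMin M.priceMax) fun x =>
      M.h s t (Function.update (fun r => π r t) s x) (M.ξ₀ s)) {p : ℝ × ℝ}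
    (hp : p ∈ M.strategyRegion s π t) :
    |p.1| ≤ M.priceMax ∧ 0 < p.2 ∧ p.2 ≤ M.demandBound s π t := by
  obtain ⟨hprice, hmin, hdemand⟩ := hp
  refine ⟨?_, M.demandMin_pos.trans_le hmin, ?_⟩
  · rw [abs_of_nonneg (M.priceMin_nonneg.trans hprice.1)]
    exact hprice.2
  · exact hdemand.trans ((M.robustDemand_le s t _).trans
      (le_two_mul_midpoint_sub_min_of_concaveOn hconc hprice))

theorem exists_isRobustBestResponse_of_forall_feasiblePrice [Countable S] {π : S → M.Path}
    (hmem : ∀ π : S → M.Path, (∀ r, M.FeasiblePrice (π r)) →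
      MemLp (M.demandPath s π (M.ξ₀ s)) 2 M.μ)
    (hcont : ∀ t ∈ Icc M.t₀ M.t_f, ∀ p ∈ M.priceBox, ∀ ξ ∈ M.U s,
      ContinuousOn (fun x => M.h s t (Function.update p s x) ξ) (Icc M.priceMin M.priceMax))
    (hconc : ∀ t ∈ Icc M.t₀ M.t_f, ∀ p ∈ M.priceBox, ∀ ξ ∈ M.U s,
      ConcaveOn ℝ (Icc M.priceMin M.priceMax) (fun x => M.h s t (Function.update p s x) ξ))
    (hlin : ∀ t ∈ Icc M.t₀ M.t_f, ∀ p ∈ M.priceBox, M.LinearInParam s t p)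
    (hπ : ∀ r, M.FeasiblePrice (π r)) (hne : (M.robustStrategySpace s π).Nonempty) :
    ∃ v : M.Path × M.Path, M.IsRobustBestResponse s π v := by
  have hhorizon : ∀ᵐ t ∂M.μ, t ∈ Icc M.t₀ M.t_f := ae_restrict_mem measurableSet_Icc
  have hglb : ∀ᵐ t ∂M.μ, ∀ x ∈ Icc M.priceMin M.priceMax,
      IsGLB (M.h s t (Function.update (fun r => π r t) s x) '' M.U s)
        (M.robustDemand s t (Function.update (fun r => π r t) s x)) := by
    filter_upwards [hhorizon, M.ae_mem_priceBox hπ] with t ht hp x hx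
    exact (hlin t ht _ (M.update_mem_priceBox hp s hx)).isGLB_robustDemand
  have hclosed : ∀ᵐ t ∂M.μ, IsClosed (revenueRegion (M.strategyRegion s π t)) := by
    filter_upwards [hhorizon, M.ae_mem_priceBox hπ, hglb] with t ht hp hglbt
    exact isClosed_revenueRegion M.demandMin_pos
      (isClosed_hypograph_of_isGLB isClosed_Icc (hcont t ht _ hp) hglbt)
  have hconv : ∀ᵐ t ∂M.μ, Convex ℝ (revenueRegion (M.strategyRegion s π t)) := by
    filter_upwards [hhorizon, M.ae_mem_priceBox hπ, hglb] with t ht hp hglbt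
    exact convex_revenueRegion M.demandMin_pos
      (concaveOn_of_isGLB (convex_Icc _ _) (hconc t ht _ hp) hglbt)
  have hbounds : ∀ᵐ t ∂M.μ, ∀ p ∈ M.strategyRegion s π t,
      |p.1| ≤ M.priceMax ∧ 0 < p.2 ∧ p.2 ≤ M.demandBound s π t := by
    filter_upwards [hhorizon, M.ae_mem_priceBox hπ] with t ht hp _
    exact M.strategyRegion_bounds (hconc t ht _ hp _ (M.nominal_mem_U s))
  rw [robustStrategySpace_eq_integralSelections] at hne
  obtain ⟨v, hv, hmax⟩ := exists_isMaxOn_integral_mul_mul M.memLp_discount hclosed hconv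
    (M.memLp_demandBound hπ hmem) hbounds hne
  rw [← robustStrategySpace_eq_integralSelections] at hv hmax
  exact ⟨v, hv, fun _ hw => hmax hw⟩

section Regular

variable {M}

theorem Regular.continuousOn_update (hM : M.Regular) (s : S) :
    ∀ t ∈ Icc M.t₀ M.t_f, ∀ p ∈ M.priceBox, ∀ ξ ∈ M.U s,
      ContinuousOn (fun x => M.h s t (Function.update p s x) ξ) (Icc M.priceMin M.priceMax) :=
  fun t ht _ hp ξ hξ => (hM.continuousOn s t ht ξ hξ).comp (by fun_prop)
    fun _ hx => M.update_mem_priceBox hp s hx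

theorem Regular.concaveOn_update (hM : M.Regular) (s : S) :
    ∀ t ∈ Icc M.t₀ M.t_f, ∀ p ∈ M.priceBox, ∀ ξ ∈ M.U s,
      ConcaveOn ℝ (Icc M.priceMin M.priceMax) (fun x => M.h s t (Function.update p s x) ξ) := by
  refine fun t ht p hp ξ hξ => ⟨convex_Icc _ _, fun x hx y hy a b ha hb hab => ?_⟩
  have hupdate : Function.update p s (a • x + b • y) =
      a • Function.update p s x + b • Function.update p s y := by
    rw [← Function.update_smul, ← Function.update_smul, ← Function.update_add, ← add_smul, hab,
      one_smul]
  simp only [hupdate]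
  exact (hM.concaveOn s t ht ξ hξ).2 (M.update_mem_priceBox hp s hx)
    (M.update_mem_priceBox hp s hy) ha hb hab

end Regular

end PricingModel

theorem theorem4_general {S : Type*} [Countable S] [DecidableEq S] {m : ℕ} (M : PricingModel S m)
    (s : S)
    (hmem : ∀ π : S → M.Path, (∀ r, M.FeasiblePrice (π r)) →
      MemLp (M.demandPath s π (M.ξ₀ s)) 2 M.μ)
    (hcont : ∀ t ∈ Icc M.t₀ M.t_f, ∀ p ∈ M.priceBox, ∀ ξ ∈ M.U s,
      ContinuousOn (fun x => M.h s t (Function.update p s x) ξ) (Icc M.priceMin M.priceMax))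
    (hconc : ∀ t ∈ Icc M.t₀ M.t_f, ∀ p ∈ M.priceBox, ∀ ξ ∈ M.U s,
      ConcaveOn ℝ (Icc M.priceMin M.priceMax) (fun x => M.h s t (Function.update p s x) ξ))
    (hlin : ∀ t ∈ Icc M.t₀ M.t_f, ∀ p ∈ M.priceBox, M.LinearInParam s t p)
    (π : S → M.Path) (hπ : ∀ r ≠ s, M.FeasiblePrice (π r))
    (hne : (M.robustStrategySpace s π).Nonempty) :
    ∃ v : M.Path × M.Path, M.IsRobustBestResponse s π v := by
  obtain ⟨v₀, hv₀⟩ := id hne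
  have hfeas : ∀ r, M.FeasiblePrice (Function.update π s v₀.1 r) :=
    (Function.forall_update_iff π fun _ x => M.FeasiblePrice x).2
      ⟨hv₀.2.2.1.and hv₀.2.2.2.1, hπ⟩
  rw [← M.robustStrategySpace_update s π v₀.1] at hne
  obtain ⟨v, hv⟩ := M.exists_isRobustBestResponse_of_forall_feasiblePrice hmem hcont hconc hlin
    hfeas hne
  exact ⟨v, by rwa [PricingModel.IsRobustBestResponse, M.robustStrategySpace_update] at hv⟩

theorem theorem4 {S : Type*} [Fintype S] [DecidableEq S] {m : ℕ} (M : PricingModel S m)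
    (hM : M.Regular) (s : S) (π : S → M.Path) (hπ : ∀ r ≠ s, M.FeasiblePrice (π r))
    (hne : (M.robustStrategySpace s π).Nonempty) :
    ∃ v : M.Path × M.Path, M.IsRobustBestResponse s π v :=
  theorem4_general M s (fun π hπ => hM.memLp s π hπ _ (M.nominal_mem_U s))
    (hM.continuousOn_update s) (hM.concaveOn_update s) (hM.linear_param s) π hπ hne
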